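/- Let $B=(B_u)_{u\ge 0}$ be a standard Brownian motion on a probability space $(\Omega,\mathcal F,\mathbb P)$. For $(s,y)\in\mathbb R_+\times\mathbb R$ let $\mathbb P_{s,y}$ (with expectation $\mathbb E_{s,y}$) be the law under which $Y_{s+u}=y+B_u$ for $u\ge 0$. Let $c_0,c_1,c_2\in\mathbb R$ and let $a_1,a_2:\mathbb R_+\to\mathbb R$ be twice continuously differentiable functions such that $a_1,a_1',a_1'',a_2,a_2',a_2''$ are bounded, $a_2(s)>0$ and $a_2'(s)<0$ for all $s\ge 0$, $\lim_{s\to\infty}a_1(s)=c_1$, and $\lim_{s\to\infty}a_2(s)\,s=c_2$. Define the gain function $$G(s,y)=a_1(s)+a_2(s)\,(c_0s+y)$$ and the value function $$W(s,y)=\sup_{\sigma}\mathbb E_{s,y}\big[G(s+\sigma,Y_{s+\sigma})\big],$$ where the supremum is over all almost surely finite stopping times $\sigma\ge 0$ of the process $(Y_{s+u})_{u\ge 0}$ under $\mathbb P_{s,y}$ (for its natural filtration). Then all these expectations are well defined and $W$ is finite; moreover, for every $(s,y)\in\mathbb R_+\times\mathbb R$, the random variable $W(s+u,Y_{s+u})$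 is $\mathbb P_{s,y}$-integrable for every $u\ge 0$, and $$\lim_{u\to\infty}\mathbb E_{s,y}\big[W(s+u,Y_{s+u})\big]=c_1+c_0c_2 .$$ -/

import Mathlib

open MeasureTheory ProbabilityTheory Filter Topology
open scoped NNReal

namespace GaussMarkovOSP

/-- Regularity of a time coefficient `a : [0,∞) → ℝ` (only the values on `[0,∞)` matter): `a` is
twice continuously differentiable on `[0,∞)`, and `a`, `a'`, `a''` are bounded there. The derivative
at `0` is the one-sided one. -/
structure IsC2Bounded (a : ℝ → ℝ) : Prop where
  contDiffOn : ContDiffOn ℝ 2 a (Set.Ici 0)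
  bounded : ∀ k : ℕ, k ≤ 2 → ∃ C : ℝ, ∀ s : ℝ, 0 ≤ s →
    |iteratedDerivWithin k a (Set.Ici 0) s| ≤ C

/-- Standing assumptions on the coefficients `a₁`, `a₂` of the gain function and on the limits
`c₁`, `c₂`. -/
structure GainAssumptions (a₁ a₂ : ℝ → ℝ) (c₁ c₂ : ℝ) : Prop where
  regular₁ : IsC2Bounded a₁
  regular₂ : IsC2Bounded a₂
  tendsto₁ : Tendsto a₁ atTop (𝓝 c₁)
  pos₂ : ∀ s : ℝ, 0 ≤ s → 0 < a₂ s
  tendsto₂ : Tendsto (fun s : ℝ => a₂ s * s) atTop (𝓝 c₂)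
  deriv_neg₂ : ∀ s : ℝ, 0 ≤ s → derivWithin a₂ (Set.Ici 0) s < 0

/-- The gain function `G(s, y) = a₁(s) + a₂(s) (c₀ s + y)`. -/
def gain (a₁ a₂ : ℝ → ℝ) (c₀ : ℝ) (s : ℝ≥0) (y : ℝ) : ℝ :=
  a₁ s + a₂ s * (c₀ * s + y)

variable {Ω : Type*} [mΩ : MeasurableSpace Ω]

/-- The process `u ↦ Y_{s+u}` under `P_{s,y}`, namely `Y_{s+u} = y + B_u` with `B` a standard
Brownian motion; as a function of the elapsed time `u` it does not depend on `s`. -/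
def startedAt (B : ℝ≥0 → Ω → ℝ) (y : ℝ) : ℝ≥0 → Ω → ℝ :=
  fun u ω => y + B u ω

theorem stronglyMeasurable_startedAt {B : ℝ≥0 → Ω → ℝ} (hB : ∀ t, Measurable (B t)) (y : ℝ)
    (u : ℝ≥0) : StronglyMeasurable (startedAt B y u) :=
  ((hB u).const_add y).stronglyMeasurable

/-- `σ` is a stopping time of `u ↦ Y_{s+u}` under `P_{s,y}` (for its natural filtration) which is
almost surely finite. -/
def IsAdmissible (P : Measure Ω) (B : ℝ≥0 → Ω → ℝ) (hB : ∀ t, Measurable (B t)) (y : ℝ)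
    (σ : Ω → WithTop ℝ≥0) : Prop :=
  IsStoppingTime (Filtration.natural (startedAt B y) (stronglyMeasurable_startedAt hB y)) σ ∧
    ∀ᵐ ω ∂P, σ ω ≠ ⊤

/-- The random variable `G(s + σ, Y_{s+σ})` under `P_{s,y}`. -/
noncomputable def gainAt (B : ℝ≥0 → Ω → ℝ) (a₁ a₂ : ℝ → ℝ) (c₀ : ℝ) (s : ℝ≥0) (y : ℝ)
    (σ : Ω → WithTop ℝ≥0) : Ω → ℝ :=
  stoppedValue (fun u ω => gain a₁ a₂ c₀ (s + u) (startedAt B y u ω)) σ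

/-- The set of all `E_{s,y}[G(s + σ, Y_{s+σ})]` for admissible `σ`. -/
def expectedGains (P : Measure Ω) (B : ℝ≥0 → Ω → ℝ) (hB : ∀ t, Measurable (B t))
    (a₁ a₂ : ℝ → ℝ) (c₀ : ℝ) (s : ℝ≥0) (y : ℝ) : Set ℝ :=
  {v | ∃ σ : Ω → WithTop ℝ≥0, IsAdmissible P B hB y σ ∧
    v = ∫ ω, gainAt B a₁ a₂ c₀ s y σ ω ∂P}

/-- The value function `W(s, y) = sup_σ E_{s,y}[G(s + σ, Y_{s+σ})]`. -/
noncomputable def value (P : Measure Ω) (B : ℝ≥0 → Ω → ℝ) (hB : ∀ t, Measurable (B t))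
    (a₁ a₂ : ℝ → ℝ) (c₀ : ℝ) (s : ℝ≥0) (y : ℝ) : ℝ :=
  sSup (expectedGains P B hB a₁ a₂ c₀ s y)

end GaussMarkovOSP

namespace GaussMarkovOSP

/-! Since a₂(t) is at most C/(1+t), the gain from (s,y) is the deterministic term `drift`, which
tends to c₁ + c₀c₂, plus a remainder bounded by C|y + B_σ|/(1+s+σ). The crux is to bound
E[|B_σ|/(r+σ)] uniformly over all almost surely finite σ. The process B_t²/(r+t)² + 1/(r+t) is a
nonnegative supermartingale with initial mean 1/r, so its mean at σ is at most 1/r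
(`integral_ratioSq_stopped_le`), and AM-GM turns this into the bound 1/√r
(`integral_abs_div_stopped_le`).

With r = 1+s, W(s,y) lies between G(s,y) and m + C|y|/(1+s) + C/√(1+s), where m bounds `drift` on
[s,∞) (`gain_le_value`, `value_le`). These bounds are then averaged at time s+u over Y_{s+u}. On the
lower side E[Y_{s+u}] = y; on the upper side E|Y_{s+u}| ≤ |y| + √(1+u) grows more slowly than 1+s+u.
Both errors vanish and the limit of `drift` is squeezed out. No description of an optimal stopping
time is needed. -/

section Martingale

variable {Ω : Type*}

/-! ### Discretization of stopping times -/

/-- The index of the first point of the grid `{k / (n + 1)}` after `σ`, capped at `(n + 1) ^ 2`. -/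
noncomputable def gridIndex (σ : Ω → WithTop ℝ≥0) (n : ℕ) (ω : Ω) : ℕ :=
  open Classical in
  if σ ω = ⊤ then (n + 1) ^ 2 else min ⌈(σ ω).untopA * ((n : ℝ≥0) + 1)⌉₊ ((n + 1) ^ 2)

/-- The `k`-th point of the grid of mesh `1 / (n + 1)`. -/
noncomputable def gridPoint (n k : ℕ) : ℝ≥0 := (k : ℝ≥0) / ((n : ℝ≥0) + 1)

theorem gridPoint_mono (n : ℕ) : Monotone (gridPoint n) := fun i j hij => by
  unfold gridPoint; gcongr

theorem gridIndex_le (σ : Ω → WithTop ℝ≥0) (n : ℕ) (ω : Ω) : gridIndex σ n ω ≤ (n + 1) ^ 2 := by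
  unfold gridIndex; split_ifs <;> simp

/-- Strictly below the cap, rounding up makes the event depend on σ only up to the grid point, which
is what makes the index a stopping time. Paths with σ = ⊤ sit at the cap and never enter. -/
theorem gridIndex_le_iff (σ : Ω → WithTop ℝ≥0) {n k : ℕ} (hk : k < (n + 1) ^ 2) (ω : Ω) :
    gridIndex σ n ω ≤ k ↔ σ ω ≤ (gridPoint n k : WithTop ℝ≥0) := by
  unfold gridIndex gridPoint
  split_ifs with h
  · refine iff_of_false hk.not_ge ?_
    rw [h, top_le_iff]
    exact WithTop.coe_ne_top
  · obtain ⟨x, hx⟩ := WithTop.ne_top_iff_exists.1 h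
    have e : (WithTop.some x).untopA = x := rfl
    rw [← hx, min_le_iff, or_iff_left hk.not_ge, e, WithTop.coe_le_coe,
      Nat.ceil_le, le_div_iff₀ (by positivity)]

theorem tendsto_gridPoint_gridIndex (σ : Ω → WithTop ℝ≥0) {ω : Ω} (h : σ ω ≠ ⊤) :
    Tendsto (fun n => gridPoint n (gridIndex σ n ω)) atTop (𝓝 (σ ω).untopA) := by
  obtain ⟨x, hx⟩ := WithTop.ne_top_iff_exists.1 h
  simp only [gridIndex, gridPoint, if_neg h]
  have e : (WithTop.some x).untopA = x := rfl
  rw [← hx, e]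
  have h1 : Tendsto (fun n : ℕ => (⌈x * ((n : ℝ≥0) + 1)⌉₊ : ℝ≥0) / ((n : ℝ≥0) + 1)) atTop
      (𝓝 x) := by
    rw [← NNReal.tendsto_coe]
    have h3 : Tendsto (fun n : ℕ => (n : ℝ) + 1) atTop atTop :=
      tendsto_atTop_add_const_right _ _ tendsto_natCast_atTop_atTop
    refine ((tendsto_nat_ceil_mul_div_atTop x.coe_nonneg).comp h3).congr fun n => ?_
    have : ⌈(x : ℝ) * ((n : ℝ) + 1)⌉₊ = ⌈x * ((n : ℝ≥0) + 1)⌉₊ :=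
      eq_of_forall_ge_iff fun m => by
        rw [Nat.ceil_le, Nat.ceil_le, ← NNReal.coe_le_coe]; push_cast; rfl
    simp [this]
  refine h1.congr' ?_
  -- The capped grid reaches time n + 1, so the cap is inactive once n ≥ x.
  filter_upwards [eventually_ge_atTop ⌈x⌉₊] with n hn
  rw [min_eq_left]
  have : x ≤ n := Nat.ceil_le.1 hn
  rw [Nat.ceil_le]
  push_cast
  rw [pow_two]
  gcongr
  exact this.trans (by simp)

/-- The process `B_t² / (r + t)² + 1 / (r + t)`. -/
noncomputable def ratioSq (B : ℝ≥0 → Ω → ℝ) (r : ℝ) (t : ℝ≥0) (ω : Ω) : ℝ :=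
  B t ω ^ 2 / (r + t) ^ 2 + 1 / (r + t)

theorem ratioSq_nonneg (B : ℝ≥0 → Ω → ℝ) {r : ℝ} (hr : 0 < r) (t : ℝ≥0) (ω : Ω) :
    0 ≤ ratioSq B r t ω := by
  unfold ratioSq; positivity

variable [mΩ : MeasurableSpace Ω]

theorem isStoppingTime_gridIndex {f : Filtration ℝ≥0 mΩ} {σ : Ω → WithTop ℝ≥0}
    (hσ : IsStoppingTime f σ) (n : ℕ) {g : Filtration ℕ mΩ} (hg : ∀ k, g k = f (gridPoint n k)) :
    IsStoppingTime g fun ω => WithTop.some (gridIndex σ n ω) := by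
  intro k
  rw [hg]
  by_cases hk : k < (n + 1) ^ 2
  · convert hσ (gridPoint n k) using 3 with ω
    exact WithTop.coe_le_coe.trans (gridIndex_le_iff σ hk ω)
  · convert MeasurableSet.univ using 1
    ext ω
    simpa using WithTop.coe_le_coe.2 ((gridIndex_le σ n ω).trans (not_lt.1 hk))

theorem measurable_gridIndex {f : Filtration ℝ≥0 mΩ} {σ : Ω → WithTop ℝ≥0}
    (hσ : IsStoppingTime f σ) (n : ℕ) : Measurable (gridIndex σ n) := by
  refine measurable_of_Iic fun k => ?_
  by_cases hk : k < (n + 1) ^ 2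
  · have : gridIndex σ n ⁻¹' Set.Iic k = {ω | σ ω ≤ (gridPoint n k : WithTop ℝ≥0)} := by
      ext ω; exact gridIndex_le_iff σ hk ω
    rw [this]
    exact f.le _ _ (hσ _)
  · convert MeasurableSet.univ using 1
    ext ω
    simpa using (gridIndex_le σ n ω).trans (not_lt.1 hk)

theorem measurable_eval_index {Y : ℕ → Ω → ℝ} (hY : ∀ k, Measurable (Y k)) {J : Ω → ℕ}
    (hJ : Measurable J) : Measurable fun ω => Y (J ω) ω :=
  (measurable_from_prod_countable_right (f := fun p : ℕ × Ω => Y p.1 p.2) hY).comp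
    (hJ.prodMk measurable_id)

theorem measurable_gridValue {f : Filtration ℝ≥0 mΩ} {σ : Ω → WithTop ℝ≥0}
    (hσ : IsStoppingTime f σ) {X : ℝ≥0 → Ω → ℝ} (hX : ∀ t, Measurable (X t)) (n : ℕ) :
    Measurable fun ω => X (gridPoint n (gridIndex σ n ω)) ω := 
  measurable_eval_index (Y := fun k => X (gridPoint n k)) (fun _ => hX _)
    (measurable_gridIndex hσ n)

theorem tendsto_gridValue {P : Measure Ω} {σ : Ω → WithTop ℝ≥0} (hfin : ∀ᵐ ω ∂P, σ ω ≠ ⊤)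
    {X : ℝ≥0 → Ω → ℝ} (hXc : ∀ᵐ ω ∂P, Continuous (X · ω)) :
    ∀ᵐ ω ∂P, Tendsto (fun n => X (gridPoint n (gridIndex σ n ω)) ω) atTop
      (𝓝 (stoppedValue X σ ω)) := by
  filter_upwards [hfin, hXc] with ω h1 h2
  exact (h2.tendsto _).comp (tendsto_gridPoint_gridIndex σ h1)

/-- Paths are continuous only almost surely, so measurability comes from the almost sure limit of
the grid values. -/
theorem aemeasurable_stoppedValue_of_continuous {P : Measure Ω} {f : Filtration ℝ≥0 mΩ}
    {σ : Ω → WithTop ℝ≥0} (hσ : IsStoppingTime f σ) (hfin : ∀ᵐ ω ∂P, σ ω ≠ ⊤)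
    {X : ℝ≥0 → Ω → ℝ} (hX : ∀ t, Measurable (X t)) (hXc : ∀ᵐ ω ∂P, Continuous (X · ω)) :
    AEMeasurable (stoppedValue X σ) P :=
  aemeasurable_of_tendsto_metrizable_ae' (fun n => (measurable_gridValue hσ hX n).aemeasurable)
    (tendsto_gridValue hfin hXc)

/-! ### A nonnegative supermartingale of Brownian motion -/

theorem measurable_ratioSq {B : ℝ≥0 → Ω → ℝ} (hB : ∀ t, Measurable (B t)) (r : ℝ) (t : ℝ≥0) :
    Measurable (ratioSq B r t) := by
  unfold ratioSq
  have := hB t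
  fun_prop

theorem memLp_two_eval {P : Measure Ω} {B : ℝ≥0 → Ω → ℝ} (hB : IsPreBrownianReal B P) (t : ℝ≥0) :
    MemLp (B t) 2 P :=
  (hB.isGaussianProcess.hasGaussianLaw_eval t).memLp_two

theorem integral_sq_eval {P : Measure Ω} {B : ℝ≥0 → Ω → ℝ} (hB : IsPreBrownianReal B P) (t : ℝ≥0) :
    ∫ ω, B t ω ^ 2 ∂P = t := by
  have := hB.isGaussianProcess.isProbabilityMeasure
  have h := hB.covariance_eval t t
  rw [covariance_self (hB.aemeasurable t), variance_of_integral_eq_zero (hB.aemeasurable t)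
    (hB.integral_eval t)] at h
  simpa using h

theorem integrable_ratioSq {P : Measure Ω} {B : ℝ≥0 → Ω → ℝ} (hB : IsPreBrownianReal B P)
    (r : ℝ) (t : ℝ≥0) : Integrable (ratioSq B r t) P := by
  have := hB.isGaussianProcess.isProbabilityMeasure
  exact ((memLp_two_eval hB t).integrable_sq.div_const _).add (integrable_const _)

theorem indep_increment_natural {P : Measure Ω} {B : ℝ≥0 → Ω → ℝ} (hB : IsPreBrownianReal B P)
    (hm : ∀ t, StronglyMeasurable (B t)) {s t : ℝ≥0} (hst : s ≤ t) :
    Indep (MeasurableSpace.comap (fun ω => B t ω - B s ω) inferInstance)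
      (Filtration.natural B hm s) P := by
  obtain ⟨h, rfl⟩ := exists_add_of_le hst
  refine indep_of_indep_of_le_left (indep_of_indep_of_le_right (hB.indepFun_shift s) ?_) ?_
  · refine iSup₂_le fun j hj => ?_
    have : B j = (fun x : Set.Iic s → ℝ => x ⟨j, hj⟩) ∘ fun ω (i : Set.Iic s) => B i ω := rfl
    rw [this, ← MeasurableSpace.comap_comp]
    exact MeasurableSpace.comap_mono (measurable_pi_apply _).comap_le
  · have : (fun ω => B (s + h) ω - B s ω) =
        (fun x : ℝ≥0 → ℝ => x h) ∘ fun ω t => B (s + t) ω - B s ω := rfl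
    rw [this, ← MeasurableSpace.comap_comp]
    exact MeasurableSpace.comap_mono (measurable_pi_apply _).comap_le

/-- The martingale property of B_t² - t: with D = B_t - B_s, expand (B_s + D)²; independence of D
from the past kills the cross term and gives D² conditional mean t - s. -/
theorem setIntegral_sq_le {P : Measure Ω} {B : ℝ≥0 → Ω → ℝ} (hB : IsPreBrownianReal B P)
    (hm : ∀ t, StronglyMeasurable (B t)) {s t : ℝ≥0} (hst : s ≤ t) {A : Set Ω}
    (hA : MeasurableSet[Filtration.natural B hm s] A) :
    ∫ ω in A, B t ω ^ 2 ∂P = ∫ ω in A, (B s ω ^ 2 + (t - s)) ∂P := by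
  have := hB.isGaussianProcess.isProbabilityMeasure
  set F := Filtration.natural B hm
  set D : Ω → ℝ := fun ω => B t ω - B s ω with hD
  have hDm : StronglyMeasurable[MeasurableSpace.comap D inferInstance] D :=
    (comap_measurable D).stronglyMeasurable
  have hDle : MeasurableSpace.comap D inferInstance ≤ mΩ :=
    ((hm t).measurable.sub (hm s).measurable).comap_le
  have hind := indep_increment_natural hB hm hst
  have hD2 : MemLp D 2 P := (memLp_two_eval hB t).sub (memLp_two_eval hB s)
  have hBs : StronglyMeasurable[F s] (B s) := Filtration.stronglyAdapted_natural hm s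
  have hDz : ∫ ω, D ω ∂P = 0 := by
    simp [hD, integral_sub (hB.integrable_eval t) (hB.integrable_eval s), hB.integral_eval]
  have hBD : ∫ ω, B s ω * D ω ∂P = 0 := by
    have h1 : IndepFun D (B s) P :=
      indep_of_indep_of_le_right hind hBs.measurable.comap_le
    rw [h1.symm.integral_fun_mul_eq_mul_integral (hm s).aestronglyMeasurable
      hD2.aestronglyMeasurable, hDz, mul_zero]
  have hDsq : ∫ ω, D ω ^ 2 ∂P = t - s := by
    have h1 : ∀ ω, D ω ^ 2 = B t ω ^ 2 - B s ω ^ 2 - 2 * (B s ω * D ω) := fun ω => by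
      simp only [hD]; ring
    simp_rw [h1]
    rw [integral_sub, integral_sub, integral_const_mul, hBD, integral_sq_eval hB,
      integral_sq_eval hB]
    · simp
    · exact (memLp_two_eval hB t).integrable_sq
    · exact (memLp_two_eval hB s).integrable_sq
    · exact (memLp_two_eval hB t).integrable_sq.sub (memLp_two_eval hB s).integrable_sq
    · exact ((memLp_two_eval hB s).integrable_mul hD2).const_mul 2
  have hint : Integrable (fun ω => B s ω * D ω) P := (memLp_two_eval hB s).integrable_mul hD2
  have c1 : P[fun ω => B s ω * D ω | F s] =ᵐ[P] 0 := by
    refine (condExp_mul_of_stronglyMeasurable_left hBs hint (hD2.integrable one_le_two)).trans ?_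
    filter_upwards [condExp_indep_eq hDle (F.le s) hDm hind] with ω hω
    simp [hω, hDz]
  have c2 : P[fun ω => D ω ^ 2 | F s] =ᵐ[P] fun _ => (t - s : ℝ) := by
    rw [← hDsq]
    exact condExp_indep_eq hDle (F.le s) (hDm.pow 2) hind
  have i1 : ∫ ω in A, B s ω * D ω ∂P = 0 := by
    rw [← setIntegral_condExp (F.le s) hint hA, setIntegral_congr_ae (g := 0) (F.le s _ hA)]
    · simp
    · filter_upwards [c1] with ω h _ using h
  have i2 : ∫ ω in A, D ω ^ 2 ∂P = ∫ ω in A, (t - s : ℝ) ∂P := by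
    rw [← setIntegral_condExp (F.le s) hD2.integrable_sq hA]
    exact setIntegral_congr_ae (F.le s _ hA) (by filter_upwards [c2] with ω h _ using h)
  have h1 : ∀ ω, B t ω ^ 2 = B s ω ^ 2 + 2 * (B s ω * D ω) + D ω ^ 2 := fun ω => by
    simp only [hD]; ring
  have hs2 := (memLp_two_eval hB s).integrable_sq
  simp_rw [h1]
  have hsD : Integrable (fun ω => B s ω ^ 2 + 2 * (B s ω * D ω)) P := hs2.add (hint.const_mul 2)
  rw [integral_add hsD.integrableOn hD2.integrable_sq.integrableOn,
    integral_add hs2.integrableOn (hint.const_mul 2).integrableOn, integral_const_mul, i1, i2,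
    integral_add hs2.integrableOn (integrable_const _)]
  simp

/-- The variance (t-s)/(r+t)² gained by the first term is paid for by the drop 1/(r+s) - 1/(r+t) of
the second. -/
theorem setIntegral_ratioSq_le {P : Measure Ω} {B : ℝ≥0 → Ω → ℝ} (hB : IsPreBrownianReal B P)
    (hm : ∀ t, StronglyMeasurable (B t)) {r : ℝ} (hr : 0 < r) {s t : ℝ≥0} (hst : s ≤ t) {A : Set Ω}
    (hA : MeasurableSet[Filtration.natural B hm s] A) :
    ∫ ω in A, ratioSq B r t ω ∂P ≤ ∫ ω in A, ratioSq B r s ω ∂P := by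
  have := hB.isGaussianProcess.isProbabilityMeasure
  have hs2 := (memLp_two_eval hB s).integrable_sq
  have ht2 := (memLp_two_eval hB t).integrable_sq
  have hst' : (s : ℝ) ≤ t := hst
  have hs0 := s.coe_nonneg
  have hst2 : Integrable (fun ω => B s ω ^ 2 + ((t : ℝ) - s)) P := hs2.add (integrable_const _)
  have e : ∫ ω in A, ratioSq B r t ω ∂P =
      ∫ ω in A, ((B s ω ^ 2 + (t - s)) / (r + t) ^ 2 + 1 / (r + t)) ∂P := by
    simp only [ratioSq]
    rw [integral_add (ht2.div_const _).integrableOn (integrable_const _),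
      integral_add (hst2.div_const _).integrableOn (integrable_const _),
      integral_div, setIntegral_sq_le hB hm hst hA,
      integral_div _ fun ω => B s ω ^ 2 + ((t : ℝ) - s)]
  rw [e]
  refine integral_mono
    ((hst2.div_const _).add (integrable_const _)).integrableOn
    (integrable_ratioSq hB r s).integrableOn fun ω => ?_
  simp only [ratioSq]
  have h1 : B s ω ^ 2 / (r + t) ^ 2 ≤ B s ω ^ 2 / (r + s) ^ 2 := by gcongr
  have h2 : ((t : ℝ) - s) / (r + t) ^ 2 + 1 / (r + t) ≤ 1 / (r + s) := by
    have hp : 0 < r + s := by positivity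
    have hq : 0 < r + t := by positivity
    have : ((t : ℝ) - s) / (r + t) ^ 2 ≤ (t - s) / ((r + s) * (r + t)) := by
      rw [pow_two]
      have : (0 : ℝ) ≤ t - s := by linarith
      gcongr
    have h3 : ((t : ℝ) - s) / ((r + s) * (r + t)) = 1 / (r + s) - 1 / (r + t) := by
      field_simp; ring
    linarith
  rw [add_div]
  linarith

/-! ### Optional stopping for almost surely finite times -/

theorem integral_ratioSq_grid_le {P : Measure Ω} {B : ℝ≥0 → Ω → ℝ}
    (hB : IsPreBrownianReal B P) (hm : ∀ t, StronglyMeasurable (B t)) {r : ℝ} (hr : 0 < r)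
    {σ : Ω → WithTop ℝ≥0} (hσ : IsStoppingTime (Filtration.natural B hm) σ) (n : ℕ) :
    Integrable (fun ω => ratioSq B r (gridPoint n (gridIndex σ n ω)) ω) P ∧
    ∫ ω, ratioSq B r (gridPoint n (gridIndex σ n ω)) ω ∂P ≤ 1 / r := by
  have := hB.isGaussianProcess.isProbabilityMeasure
  let g : Filtration ℕ mΩ :=
    { seq := fun k => Filtration.natural B hm (gridPoint n k)
      mono' := fun i j hij => (Filtration.natural B hm).mono (gridPoint_mono n hij)
      le' := fun k => (Filtration.natural B hm).le _ }
  have hsuper : Supermartingale (fun k => ratioSq B r (gridPoint n k)) g P := by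
    refine supermartingale_of_setIntegral_succ_le (fun k => ?_)
      (fun k => integrable_ratioSq hB r _)
      fun k A hA => setIntegral_ratioSq_le hB hm hr (gridPoint_mono n k.le_succ) hA
    have h1 : StronglyMeasurable[g k] (B (gridPoint n k)) := Filtration.stronglyAdapted_natural hm _
    exact ((h1.pow 2).div stronglyMeasurable_const).add stronglyMeasurable_const
  have hst := isStoppingTime_gridIndex hσ n (g := g) fun k => rfl
  have hb : ∀ ω, WithTop.some (gridIndex σ n ω) ≤ WithTop.some ((n + 1) ^ 2) := fun ω =>
    WithTop.coe_le_coe.2 (gridIndex_le σ n ω)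
  refine ⟨integrable_stoppedValue ℕ hst (fun k => integrable_ratioSq hB r (gridPoint n k)) hb,
    ?_⟩
  -- Optional stopping between the index 0 and the capped index, applied to the negated process, a
  -- submartingale.
  have h := hsuper.neg.expected_stoppedValue_mono (isStoppingTime_const g 0) hst
    (fun ω => WithTop.coe_le_coe.2 (Nat.zero_le _)) hb
  have e1 : ∫ ω, stoppedValue (-fun k => ratioSq B r (gridPoint n k))
      (fun _ => WithTop.some 0) ω ∂P = -(1 / r) := by
    rw [show stoppedValue (-fun k => ratioSq B r (gridPoint n k)) (fun _ => WithTop.some 0)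
      = fun ω => -ratioSq B r 0 ω by
        ext ω; simp [stoppedValue, gridPoint], integral_neg]
    congr 1
    simp only [ratioSq]
    rw [integral_add ((memLp_two_eval hB 0).integrable_sq.div_const _) (integrable_const _),
      integral_div, integral_sq_eval hB]
    simp
  have e2 : ∫ ω, stoppedValue (-fun k => ratioSq B r (gridPoint n k))
      (fun ω => WithTop.some (gridIndex σ n ω)) ω ∂P =
      -∫ ω, ratioSq B r (gridPoint n (gridIndex σ n ω)) ω ∂P := by
    rw [← integral_neg]; rfl
  rw [e1, e2] at h
  linarith

/-- Fatou's lemma along the grid approximations: nonnegativity replaces any uniform integrability or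
bound on σ. -/
theorem integral_ratioSq_stopped_le {P : Measure Ω} {B : ℝ≥0 → Ω → ℝ}
    (hB : IsBrownianReal B P) (hm : ∀ t, StronglyMeasurable (B t)) {r : ℝ} (hr : 0 < r)
    {σ : Ω → WithTop ℝ≥0} (hσ : IsStoppingTime (Filtration.natural B hm) σ)
    (hfin : ∀ᵐ ω ∂P, σ ω ≠ ⊤) :
    Integrable (stoppedValue (ratioSq B r) σ) P ∧
    ∫ ω, stoppedValue (ratioSq B r) σ ω ∂P ≤ 1 / r := by
  have hmeas : ∀ t, Measurable (ratioSq B r t) :=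
    measurable_ratioSq (fun t => (hm t).measurable) r
  have hcont : ∀ᵐ ω ∂P, Continuous (ratioSq B r · ω) := by
    filter_upwards [hB.cont] with ω h
    unfold ratioSq
    refine ((h.pow 2).div (by fun_prop) fun t => ?_).add
      (continuous_const.div (by fun_prop) fun t => ?_) <;> positivity
  have hnn : ∀ ω, 0 ≤ stoppedValue (ratioSq B r) σ ω := fun ω => ratioSq_nonneg B hr _ _
  have hae : AEMeasurable (stoppedValue (ratioSq B r) σ) P :=
    aemeasurable_stoppedValue_of_continuous hσ hfin hmeas hcont
  have key : ∫⁻ ω, ENNReal.ofReal (stoppedValue (ratioSq B r) σ ω) ∂P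
      ≤ ENNReal.ofReal (1 / r) := by
    have hlim := tendsto_gridValue hfin hcont
    calc ∫⁻ ω, ENNReal.ofReal (stoppedValue (ratioSq B r) σ ω) ∂P
        = ∫⁻ ω, liminf (fun n => ENNReal.ofReal
            (ratioSq B r (gridPoint n (gridIndex σ n ω)) ω)) atTop ∂P := by
          refine lintegral_congr_ae ?_
          filter_upwards [hlim] with ω h
          exact ((ENNReal.continuous_ofReal.tendsto _).comp h).liminf_eq.symm
      _ ≤ liminf (fun n => ∫⁻ ω, ENNReal.ofReal
            (ratioSq B r (gridPoint n (gridIndex σ n ω)) ω) ∂P) atTop :=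
          lintegral_liminf_le fun n => (measurable_gridValue hσ hmeas n).ennreal_ofReal
      _ ≤ ENNReal.ofReal (1 / r) := by
          refine liminf_le_of_frequently_le' (Frequently.of_forall fun n => ?_)
          obtain ⟨h1, h2⟩ := integral_ratioSq_grid_le hB.toIsPreBrownianReal hm hr hσ n
          rw [← ofReal_integral_eq_lintegral_ofReal h1
            (ae_of_all _ fun ω => ratioSq_nonneg B hr _ _)]
          exact ENNReal.ofReal_le_ofReal h2
  have hint : Integrable (stoppedValue (ratioSq B r) σ) P := by
    refine ⟨hae.aestronglyMeasurable, ?_⟩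
    rw [hasFiniteIntegral_iff_ofReal (ae_of_all _ hnn)]
    exact key.trans_lt ENNReal.ofReal_lt_top
  refine ⟨hint, ?_⟩
  rw [← ofReal_integral_eq_lintegral_ofReal hint (ae_of_all _ hnn)] at key
  exact (ENNReal.ofReal_le_ofReal_iff (by positivity)).1 key

theorem integral_abs_div_stopped_le {P : Measure Ω} {B : ℝ≥0 → Ω → ℝ}
    (hB : IsBrownianReal B P) (hm : ∀ t, StronglyMeasurable (B t)) {r : ℝ} (hr : 0 < r)
    {σ : Ω → WithTop ℝ≥0} (hσ : IsStoppingTime (Filtration.natural B hm) σ)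
    (hfin : ∀ᵐ ω ∂P, σ ω ≠ ⊤) :
    Integrable (stoppedValue (fun t ω => |B t ω| / (r + t)) σ) P ∧
    ∫ ω, stoppedValue (fun t ω => |B t ω| / (r + t)) σ ω ∂P ≤ 1 / √r := by
  have := hB.isGaussianProcess.isProbabilityMeasure
  obtain ⟨h1, h2⟩ := integral_ratioSq_stopped_le hB hm hr hσ hfin
  have hq : 0 < √r := Real.sqrt_pos.2 hr
  -- AM-GM, 2x ≤ 1/√r + √r x². The weight √r balances the two terms, since the mean of x² is at most
  -- 1/r.
  have hbd : ∀ ω, stoppedValue (fun t ω => |B t ω| / (r + t)) σ ω ≤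
      (1 / √r + √r * stoppedValue (ratioSq B r) σ ω) / 2 := by
    intro ω
    simp only [stoppedValue, ratioSq]
    generalize (σ ω).untopA = t
    have hp : 0 < r + t := by positivity
    set x := |B t ω| / (r + t) with hx
    have : B t ω ^ 2 / (r + t) ^ 2 = x ^ 2 := by rw [hx, div_pow, sq_abs]
    rw [this]
    have h3 : 0 ≤ √r * (1 / (r + t)) := by positivity
    have h4 : 1 / √r + √r * x ^ 2 - 2 * x = √r * (x - 1 / √r) ^ 2 := by
      field_simp; ring
    have h5 : 0 ≤ √r * (x - 1 / √r) ^ 2 := by positivity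
    linarith
  have hae : AEMeasurable (stoppedValue (fun t ω => |B t ω| / (r + t)) σ) P := by
    refine aemeasurable_stoppedValue_of_continuous hσ hfin
      (fun t => ((hm t).measurable.abs).div_const _) ?_
    filter_upwards [hB.cont] with ω h
    refine h.abs.div (by fun_prop) fun t => ?_
    positivity
  have hint2 : Integrable (fun ω => (1 / √r + √r * stoppedValue (ratioSq B r) σ ω) / 2) P :=
    ((integrable_const _).add (h1.const_mul _)).div_const _
  have hint : Integrable (stoppedValue (fun t ω => |B t ω| / (r + t)) σ) P := by
    refine hint2.mono' hae.aestronglyMeasurable (ae_of_all _ fun ω => ?_)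
    rw [Real.norm_of_nonneg (by simp only [stoppedValue]; positivity)]
    exact hbd ω
  refine ⟨hint, (integral_mono hint hint2 hbd).trans ?_⟩
  rw [integral_div, integral_add (integrable_const _) (h1.const_mul _), integral_const_mul]
  simp only [integral_const, probReal_univ, smul_eq_mul, one_mul]
  have h6 : √r * ∫ ω, stoppedValue (ratioSq B r) σ ω ∂P ≤ √r * (1 / r) := by gcongr
  have h7 : √r * (1 / r) = 1 / √r := by
    field_simp; rw [Real.sq_sqrt hr.le]
  linarith

end Martingale

section Value

/-! ### Bounds on the coefficients -/

theorem IsC2Bounded.exists_abs_le {a : ℝ → ℝ} (h : IsC2Bounded a) :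
    ∃ C : ℝ, ∀ s : ℝ, 0 ≤ s → |a s| ≤ C := by
  simpa using h.bounded 0 (by norm_num)

theorem GainAssumptions.exists_abs_mul_le {a₁ a₂ : ℝ → ℝ} {c₁ c₂ : ℝ}
    (h : GainAssumptions a₁ a₂ c₁ c₂) :
    ∃ C : ℝ, 0 ≤ C ∧ ∀ t : ℝ, 0 ≤ t → |a₂ t| ≤ C / (1 + t) := by
  obtain ⟨K, hK⟩ := h.regular₂.exists_abs_le
  have hK0 : 0 ≤ K := (abs_nonneg _).trans (hK 0 le_rfl)
  have hev : ∀ᶠ t : ℝ in atTop, a₂ t * t < c₂ + 1 := h.tendsto₂.eventually_lt_const (by linarith)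
  obtain ⟨T, hT⟩ := eventually_atTop.1 hev
  -- This bounds a₂(t) + a₂(t)t: K bounds the first summand; K|T| bounds the second before T, and c₂
  -- + 1 after T.
  refine ⟨K + K * |T| + |c₂ + 1|, by positivity, fun t ht => ?_⟩
  have ha := hK t ht
  rw [abs_of_pos (h.pos₂ t ht)] at ha ⊢
  rw [le_div_iff₀ (by positivity)]
  rcases le_total T t with htT | htT
  · have h1 := hT t htT
    have h2 := le_abs_self (c₂ + 1)
    have h3 : 0 ≤ K * |T| := by positivity
    linarith
  · have h1 : a₂ t * t ≤ K * |T| :=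
      mul_le_mul ha (htT.trans (le_abs_self _)) ht hK0
    have h2 := abs_nonneg (c₂ + 1)
    linarith

/-- The part of the gain function that does not depend on the space variable. -/
def drift (a₁ a₂ : ℝ → ℝ) (c₀ t : ℝ) : ℝ := a₁ t + a₂ t * (c₀ * t)

theorem gain_eq (a₁ a₂ : ℝ → ℝ) (c₀ : ℝ) (s : ℝ≥0) (y : ℝ) :
    gain a₁ a₂ c₀ s y = drift a₁ a₂ c₀ s + a₂ s * y := by
  unfold gain drift; ring

theorem GainAssumptions.tendsto_drift {a₁ a₂ : ℝ → ℝ} {c₁ c₂ : ℝ}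
    (h : GainAssumptions a₁ a₂ c₁ c₂) (c₀ : ℝ) :
    Tendsto (drift a₁ a₂ c₀) atTop (𝓝 (c₁ + c₀ * c₂)) :=
  (h.tendsto₁.add (h.tendsto₂.const_mul c₀)).congr fun t => by unfold drift; ring

theorem GainAssumptions.exists_abs_drift_le {a₁ a₂ : ℝ → ℝ} {c₁ c₂ : ℝ}
    (h : GainAssumptions a₁ a₂ c₁ c₂) (c₀ : ℝ) :
    ∃ M : ℝ, ∀ t : ℝ, 0 ≤ t → |drift a₁ a₂ c₀ t| ≤ M := by
  obtain ⟨K, hK⟩ := h.regular₁.exists_abs_le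
  obtain ⟨C, hC, hCt⟩ := h.exists_abs_mul_le
  refine ⟨K + C * |c₀|, fun t ht => ?_⟩
  have h1 : |a₂ t * (c₀ * t)| ≤ C * |c₀| := by
    rw [abs_mul, abs_mul, abs_of_nonneg ht]
    calc |a₂ t| * (|c₀| * t) ≤ C / (1 + t) * (|c₀| * (1 + t)) := by
          gcongr
          · exact hCt t ht
          · linarith
      _ = C * |c₀| := by field_simp
  exact (abs_add_le _ _).trans (add_le_add (hK t ht) h1)

theorem IsC2Bounded.continuous_add_left {a : ℝ → ℝ} (h : IsC2Bounded a) (s : ℝ≥0) :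
    Continuous fun u : ℝ≥0 => a (s + u) := by
  refine h.contDiffOn.continuousOn.comp_continuous (by fun_prop) fun u => ?_
  exact add_nonneg s.coe_nonneg u.coe_nonneg

/-! ### Bounds on the value function -/

variable {Ω : Type*}

theorem gainAt_eq (B : ℝ≥0 → Ω → ℝ) (a₁ a₂ : ℝ → ℝ) (c₀ : ℝ) (s : ℝ≥0) (y : ℝ)
    (σ : Ω → WithTop ℝ≥0) (ω : Ω) :
    gainAt B a₁ a₂ c₀ s y σ ω = drift a₁ a₂ c₀ (s + (σ ω).untopA) +
      a₂ (s + (σ ω).untopA) * (y + B (σ ω).untopA ω) := by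
  simp only [gainAt, stoppedValue, startedAt, gain_eq, NNReal.coe_add]

variable [mΩ : MeasurableSpace Ω]

/-- Two starting points differ by a constant shift, so all of them share the same filtration and the
same admissible times. -/
theorem natural_startedAt_le {B : ℝ≥0 → Ω → ℝ} (hB : ∀ t, Measurable (B t)) (y y' : ℝ) (t : ℝ≥0) :
    Filtration.natural (startedAt B y) (stronglyMeasurable_startedAt hB y) t ≤
      Filtration.natural (startedAt B y') (stronglyMeasurable_startedAt hB y') t := by
  refine iSup₂_le fun j hj => ?_
  have hadp : StronglyMeasurable[Filtration.natural (startedAt B y')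
      (stronglyMeasurable_startedAt hB y') t] (startedAt B y' j) :=
    (Filtration.stronglyAdapted_natural (stronglyMeasurable_startedAt hB y') j).mono
      ((Filtration.natural (startedAt B y') (stronglyMeasurable_startedAt hB y')).mono hj)
  have e : startedAt B y j = fun ω => (y - y') + startedAt B y' j ω := by
    ext ω; unfold startedAt; ring
  rw [e]
  exact (hadp.measurable.const_add (y - y')).comap_le

theorem IsAdmissible.change_start {P : Measure Ω} {B : ℝ≥0 → Ω → ℝ} {hB : ∀ t, Measurable (B t)}
    {y : ℝ} {σ : Ω → WithTop ℝ≥0} (h : IsAdmissible P B hB y σ) (y' : ℝ) :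
    IsAdmissible P B hB y' σ :=
  ⟨fun t => natural_startedAt_le hB y y' t _ (h.1 t), h.2⟩

theorem IsAdmissible.isStoppingTime_natural {P : Measure Ω} {B : ℝ≥0 → Ω → ℝ}
    {hB : ∀ t, Measurable (B t)} {y : ℝ} {σ : Ω → WithTop ℝ≥0} (h : IsAdmissible P B hB y σ) :
    IsStoppingTime (Filtration.natural B fun t => (hB t).stronglyMeasurable) σ := by
  have e : startedAt B 0 = B := by ext t ω; simp [startedAt]
  have h0 := (h.change_start 0).1
  simp only [e] at h0
  exact h0

/-- Assumptions on the Brownian motion and the coefficients, with explicit bounds. -/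
structure BoundedSetting (P : Measure Ω) (B : ℝ≥0 → Ω → ℝ) (a₁ a₂ : ℝ → ℝ) (c₀ C M : ℝ) :
    Prop where
  meas : ∀ t, Measurable (B t)
  brownian : IsBrownianReal B P
  reg₁ : IsC2Bounded a₁
  reg₂ : IsC2Bounded a₂
  nonneg : 0 ≤ C
  abs_le : ∀ t : ℝ, 0 ≤ t → |a₂ t| ≤ C / (1 + t)
  abs_drift_le : ∀ t : ℝ, 0 ≤ t → |drift a₁ a₂ c₀ t| ≤ M

namespace BoundedSetting

variable {P : Measure Ω} {B : ℝ≥0 → Ω → ℝ} {a₁ a₂ : ℝ → ℝ} {c₀ C M : ℝ}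

theorem isProbabilityMeasure (S : BoundedSetting P B a₁ a₂ c₀ C M) : IsProbabilityMeasure P :=
  have hB := S.brownian
  hB.isGaussianProcess.isProbabilityMeasure

theorem integral_abs_stopped_le (S : BoundedSetting P B a₁ a₂ c₀ C M) (s : ℝ≥0) {y : ℝ}
    {σ : Ω → WithTop ℝ≥0} (hσ : IsAdmissible P B S.meas y σ) :
    Integrable (stoppedValue (fun t ω => |B t ω| / (1 + s + t)) σ) P ∧
    ∫ ω, stoppedValue (fun t ω => |B t ω| / (1 + s + t)) σ ω ∂P ≤ 1 / √(1 + s) :=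
  integral_abs_div_stopped_le S.brownian _ (by positivity) hσ.isStoppingTime_natural hσ.2

/-- The elapsed time u is dropped for the starting point but kept for the Brownian part, where it is
needed to offset the growth of B at the stopping time. -/
theorem abs_coeff_mul_le (S : BoundedSetting P B a₁ a₂ c₀ C M) (s u : ℝ≥0) (x y : ℝ) :
    |a₂ (s + u) * (y + x)| ≤ C * |y| / (1 + s) + C * (|x| / (1 + s + u)) := by
  have hC := S.nonneg
  rw [abs_mul]
  calc |a₂ (s + u)| * |y + x| ≤ C / (1 + (s + u)) * (|y| + |x|) := by
        gcongr
        · exact S.abs_le _ (by positivity)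
        · exact abs_add_le _ _
    _ = C * |y| / (1 + s + u) + C * (|x| / (1 + s + u)) := by rw [← add_assoc]; ring
    _ ≤ _ := add_le_add
        (div_le_div_of_nonneg_left (by positivity) (by positivity) (by simp)) le_rfl

theorem aemeasurable_gainAt (S : BoundedSetting P B a₁ a₂ c₀ C M) (s : ℝ≥0) {y : ℝ}
    {σ : Ω → WithTop ℝ≥0} (hσ : IsAdmissible P B S.meas y σ) :
    AEMeasurable (gainAt B a₁ a₂ c₀ s y σ) P := by
  refine aemeasurable_stoppedValue_of_continuous hσ.1 hσ.2 (fun t => ?_) ?_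
  · have := S.meas t
    unfold gain startedAt
    fun_prop
  · filter_upwards [S.brownian.cont] with ω h
    have h1 := S.reg₁.continuous_add_left s
    have h2 := S.reg₂.continuous_add_left s
    unfold gain startedAt
    push_cast
    refine h1.add (h2.mul ?_)
    fun_prop

theorem integrable_gainAt (S : BoundedSetting P B a₁ a₂ c₀ C M) (s : ℝ≥0) {y : ℝ}
    {σ : Ω → WithTop ℝ≥0} (hσ : IsAdmissible P B S.meas y σ) :
    Integrable (gainAt B a₁ a₂ c₀ s y σ) P := by
  have := S.isProbabilityMeasure
  have hi := (S.integral_abs_stopped_le s hσ).1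
  refine ((integrable_const (M + C * |y| / (1 + s))).add (hi.const_mul C)).mono'
    (S.aemeasurable_gainAt s hσ).aestronglyMeasurable (ae_of_all _ fun ω => ?_)
  rw [gainAt_eq, Real.norm_eq_abs]
  have h1 := S.abs_drift_le (s + (σ ω).untopA) (by positivity)
  have h2 := S.abs_coeff_mul_le s (σ ω).untopA (B (σ ω).untopA ω) y
  refine (abs_add_le _ _).trans ((add_le_add h1 h2).trans_eq ?_)
  simp only [Pi.add_apply, stoppedValue]
  ring

theorem integral_gainAt_le (S : BoundedSetting P B a₁ a₂ c₀ C M) {s : ℝ≥0} {m : ℝ}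
    (hm : ∀ t : ℝ, s ≤ t → drift a₁ a₂ c₀ t ≤ m) {y : ℝ}
    {σ : Ω → WithTop ℝ≥0} (hσ : IsAdmissible P B S.meas y σ) :
    ∫ ω, gainAt B a₁ a₂ c₀ s y σ ω ∂P ≤ m + C * |y| / (1 + s) + C / √(1 + s) := by
  have := S.isProbabilityMeasure
  have hC := S.nonneg
  obtain ⟨hi, hle⟩ := S.integral_abs_stopped_le s hσ
  calc ∫ ω, gainAt B a₁ a₂ c₀ s y σ ω ∂P
      ≤ ∫ ω, (m + C * |y| / (1 + s) +
          C * stoppedValue (fun t ω => |B t ω| / (1 + s + t)) σ ω) ∂P := by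
        refine integral_mono (S.integrable_gainAt s hσ)
          ((integrable_const _).add (hi.const_mul C)) fun ω => ?_
        rw [gainAt_eq]
        have h1 := hm (s + (σ ω).untopA) (by simp)
        have h2 := (le_abs_self _).trans (S.abs_coeff_mul_le s (σ ω).untopA (B (σ ω).untopA ω) y)
        simp only [stoppedValue]
        linarith
    _ = m + C * |y| / (1 + s) +
          C * ∫ ω, stoppedValue (fun t ω => |B t ω| / (1 + s + t)) σ ω ∂P := by
        rw [integral_add (integrable_const _) (hi.const_mul C), integral_const_mul]
        simp
    _ ≤ m + C * |y| / (1 + s) + C * (1 / √(1 + s)) := by gcongr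
    _ = _ := by ring

theorem bddAbove_expectedGains (S : BoundedSetting P B a₁ a₂ c₀ C M) (s : ℝ≥0) (y : ℝ) :
    BddAbove (expectedGains P B S.meas a₁ a₂ c₀ s y) := by
  refine ⟨M + C * |y| / (1 + s) + C / √(1 + s), ?_⟩
  rintro _ ⟨σ, hσ, rfl⟩
  exact S.integral_gainAt_le
    (fun t ht => (le_abs_self _).trans (S.abs_drift_le t (s.coe_nonneg.trans ht))) hσ

theorem isAdmissible_zero (S : BoundedSetting P B a₁ a₂ c₀ C M) (y : ℝ) :
    IsAdmissible P B S.meas y fun _ => ((0 : ℝ≥0) : WithTop ℝ≥0) :=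
  ⟨isStoppingTime_const _ 0, ae_of_all _ fun _ => WithTop.coe_ne_top⟩

theorem gain_mem_expectedGains (S : BoundedSetting P B a₁ a₂ c₀ C M) (s : ℝ≥0) (y : ℝ) :
    gain a₁ a₂ c₀ s y ∈ expectedGains P B S.meas a₁ a₂ c₀ s y := by
  have := S.isProbabilityMeasure
  refine ⟨_, S.isAdmissible_zero y, ?_⟩
  have h : (fun ω => gainAt B a₁ a₂ c₀ s y (fun _ => ((0 : ℝ≥0) : WithTop ℝ≥0)) ω) =ᵐ[P]
      fun _ => gain a₁ a₂ c₀ s y := by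
    filter_upwards [S.brownian.eval_zero_ae_eq_zero] with ω h0
    change gain a₁ a₂ c₀ (s + 0) (y + B 0 ω) = _
    rw [h0, add_zero, add_zero]
  rw [integral_congr_ae h]
  simp

theorem gain_le_value (S : BoundedSetting P B a₁ a₂ c₀ C M) (s : ℝ≥0) (y : ℝ) :
    gain a₁ a₂ c₀ s y ≤ value P B S.meas a₁ a₂ c₀ s y :=
  le_csSup (S.bddAbove_expectedGains s y) (S.gain_mem_expectedGains s y)

theorem value_le (S : BoundedSetting P B a₁ a₂ c₀ C M) {s : ℝ≥0} {m : ℝ}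
    (hm : ∀ t : ℝ, s ≤ t → drift a₁ a₂ c₀ t ≤ m) (y : ℝ) :
    value P B S.meas a₁ a₂ c₀ s y ≤ m + C * |y| / (1 + s) + C / √(1 + s) := by
  refine csSup_le ⟨_, S.gain_mem_expectedGains s y⟩ ?_
  rintro _ ⟨σ, hσ, rfl⟩
  exact S.integral_gainAt_le hm hσ

/-- Any stopping time for one start can be used from the other, changing the gain by a₂ times the
shift. The resulting Lipschitz bound supplies the measurability of W in y. -/
theorem value_le_value_add (S : BoundedSetting P B a₁ a₂ c₀ C M) (s : ℝ≥0) (y y' : ℝ) :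
    value P B S.meas a₁ a₂ c₀ s y ≤ value P B S.meas a₁ a₂ c₀ s y' + C * |y - y'| := by
  have := S.isProbabilityMeasure
  refine csSup_le ⟨_, S.gain_mem_expectedGains s y⟩ ?_
  rintro _ ⟨σ, hσ, rfl⟩
  have hσ' := hσ.change_start y'
  have hi := S.integrable_gainAt s hσ'
  have h1 : ∫ ω, gainAt B a₁ a₂ c₀ s y' σ ω ∂P ≤ value P B S.meas a₁ a₂ c₀ s y' :=
    le_csSup (S.bddAbove_expectedGains s y') ⟨σ, hσ', rfl⟩
  have h2 : ∫ ω, gainAt B a₁ a₂ c₀ s y σ ω ∂P ≤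
      ∫ ω, (gainAt B a₁ a₂ c₀ s y' σ ω + C * |y - y'|) ∂P := by
    refine integral_mono (S.integrable_gainAt s hσ) (hi.add (integrable_const _)) fun ω => ?_
    simp only [gainAt_eq]
    set t : ℝ := s + (σ ω).untopA
    have ht : 0 ≤ t := by positivity
    have h3 : a₂ t * (y - y') ≤ C * |y - y'| := by
      refine (le_abs_self _).trans ?_
      rw [abs_mul]
      gcongr
      exact (S.abs_le t ht).trans (div_le_self S.nonneg (by linarith))
    linarith
  rw [integral_add hi (integrable_const _)] at h2
  simp only [integral_const, probReal_univ, one_smul] at h2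
  linarith

theorem continuous_value (S : BoundedSetting P B a₁ a₂ c₀ C M) (s : ℝ≥0) :
    Continuous (value P B S.meas a₁ a₂ c₀ s) :=
  (LipschitzWith.of_le_add_mul ⟨C, S.nonneg⟩ fun y y' => by
    rw [Real.dist_eq]; exact S.value_le_value_add s y y').continuous

theorem abs_value_le (S : BoundedSetting P B a₁ a₂ c₀ C M) (s : ℝ≥0) (y : ℝ) :
    |value P B S.meas a₁ a₂ c₀ s y| ≤ M + C * |y| / (1 + s) + C / √(1 + s) := by
  have hC := S.nonneg
  have hd := S.abs_drift_le s s.coe_nonneg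
  refine abs_le'.2 ⟨S.value_le
    (fun t ht => (le_abs_self _).trans (S.abs_drift_le t (s.coe_nonneg.trans ht))) y, ?_⟩
  have h1 := S.gain_le_value s y
  -- With zero elapsed time and zero increment this bounds |a₂(s) y| alone.
  have h2 := S.abs_coeff_mul_le s 0 0 y
  rw [gain_eq] at h1
  simp only [NNReal.coe_zero, add_zero, abs_zero, zero_div, mul_zero] at h2
  have h3 : 0 ≤ C / √(1 + s) := by positivity
  have h4 := neg_abs_le (a₂ s * y)
  have h5 := neg_abs_le (drift a₁ a₂ c₀ s)
  linarith

/-! ### Averaging the value function over the process -/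

theorem integrable_startedAt (S : BoundedSetting P B a₁ a₂ c₀ C M) (y : ℝ) (u : ℝ≥0) :
    Integrable (startedAt B y u) P := by
  have := S.isProbabilityMeasure
  exact (integrable_const y).add (S.brownian.integrable_eval u)

theorem integrable_value (S : BoundedSetting P B a₁ a₂ c₀ C M) (s : ℝ≥0) (y : ℝ) (u : ℝ≥0) :
    Integrable (fun ω => value P B S.meas a₁ a₂ c₀ s (startedAt B y u ω)) P := by
  have := S.isProbabilityMeasure
  refine (((integrable_const M).add
    (((S.integrable_startedAt y u).abs.const_mul C).div_const (1 + (s : ℝ)))).add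
      (integrable_const (C / √(1 + (s : ℝ))))).mono'
    ((S.continuous_value s).measurable.comp
      ((S.meas u).const_add y)).aestronglyMeasurable (ae_of_all _ fun ω => ?_)
  rw [Real.norm_eq_abs]
  exact S.abs_value_le s _

theorem integral_abs_startedAt_le (S : BoundedSetting P B a₁ a₂ c₀ C M) (y : ℝ) (u : ℝ≥0) :
    ∫ ω, |startedAt B y u ω| ∂P ≤ |y| + √(1 + u) := by
  have := S.isProbabilityMeasure
  have hsq := (memLp_two_eval S.brownian.toIsPreBrownianReal u).integrable_sq
  -- The 1 keeps q positive at u = 0, so that AM-GM with weight q applies.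
  set q := √(1 + (u : ℝ))
  have hq : 0 < q := Real.sqrt_pos.2 (by positivity)
  have hq2 : q ^ 2 = 1 + u := Real.sq_sqrt (by positivity)
  calc ∫ ω, |startedAt B y u ω| ∂P ≤ ∫ ω, (|y| + q / 2 + B u ω ^ 2 / (2 * q)) ∂P := by
        refine integral_mono (S.integrable_startedAt y u).abs
          ((integrable_const _).add (hsq.div_const _)) fun ω => ?_
        have h1 : |y + B u ω| ≤ |y| + |B u ω| := abs_add_le _ _
        have h2 : |B u ω| ≤ q / 2 + B u ω ^ 2 / (2 * q) := by
          rw [← sq_abs (B u ω)]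
          have h3 : q / 2 + |B u ω| ^ 2 / (2 * q) - |B u ω| = (q - |B u ω|) ^ 2 / (2 * q) := by
            field_simp; ring
          have h4 : 0 ≤ (q - |B u ω|) ^ 2 / (2 * q) := by positivity
          linarith
        simp only [startedAt]
        linarith
    _ = |y| + q / 2 + u / (2 * q) := by
        rw [integral_add (integrable_const _) (hsq.div_const _), integral_div,
          integral_sq_eval S.brownian.toIsPreBrownianReal]
        simp
    _ ≤ |y| + q := by
        have : (u : ℝ) / (2 * q) ≤ q / 2 := by
          rw [div_le_div_iff₀ (by positivity) (by positivity)]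
          nlinarith
        linarith

theorem le_integral_value (S : BoundedSetting P B a₁ a₂ c₀ C M) (s : ℝ≥0) (y : ℝ) (u : ℝ≥0) :
    drift a₁ a₂ c₀ s - C * |y| / (1 + s) ≤
      ∫ ω, value P B S.meas a₁ a₂ c₀ s (startedAt B y u ω) ∂P := by
  have := S.isProbabilityMeasure
  have hi : Integrable (fun ω => a₂ s * startedAt B y u ω) P :=
    (S.integrable_startedAt y u).const_mul _
  calc drift a₁ a₂ c₀ s - C * |y| / (1 + s) ≤ drift a₁ a₂ c₀ s + a₂ s * y := by
        have h2 := S.abs_coeff_mul_le s 0 0 y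
        simp only [NNReal.coe_zero, add_zero, abs_zero, zero_div, mul_zero] at h2
        have h4 := neg_abs_le (a₂ s * y)
        linarith
    _ = ∫ ω, (drift a₁ a₂ c₀ s + a₂ s * startedAt B y u ω) ∂P := by
        rw [integral_add (integrable_const _) hi, integral_const_mul]
        simp only [startedAt]
        rw [integral_add (integrable_const _) (S.brownian.integrable_eval u),
          S.brownian.integral_eval]
        simp
    _ ≤ _ := integral_mono ((integrable_const _).add hi) (S.integrable_value s y u) fun ω => by
        have := S.gain_le_value s (startedAt B y u ω)
        rwa [gain_eq] at this

/-- Here s is the current time, so the elapsed time u is at most s; hence √(1+u) ≤ √(1+s), and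
averaging |Y| costs only a second term C/√(1+s). -/
theorem integral_value_le (S : BoundedSetting P B a₁ a₂ c₀ C M) {s : ℝ≥0} {m : ℝ}
    (hm : ∀ t : ℝ, s ≤ t → drift a₁ a₂ c₀ t ≤ m) (y : ℝ) {u : ℝ≥0} (hus : u ≤ s) :
    ∫ ω, value P B S.meas a₁ a₂ c₀ s (startedAt B y u ω) ∂P ≤
      m + C * |y| / (1 + s) + 2 * C / √(1 + s) := by
  have := S.isProbabilityMeasure
  have hC := S.nonneg
  have hi : Integrable (fun ω => C * |startedAt B y u ω| / (1 + s)) P :=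
    ((S.integrable_startedAt y u).abs.const_mul C).div_const _
  have hi2 : Integrable (fun ω => m + C * |startedAt B y u ω| / (1 + s)) P :=
    (integrable_const _).add hi
  have hq : 0 < √(1 + (s : ℝ)) := Real.sqrt_pos.2 (by positivity)
  calc ∫ ω, value P B S.meas a₁ a₂ c₀ s (startedAt B y u ω) ∂P
      ≤ ∫ ω, (m + C * |startedAt B y u ω| / (1 + s) + C / √(1 + s)) ∂P :=
        integral_mono (S.integrable_value s y u) (hi2.add (integrable_const _))
          fun ω => S.value_le hm _
    _ = m + C * (∫ ω, |startedAt B y u ω| ∂P) / (1 + s) + C / √(1 + s) := by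
        rw [integral_add hi2 (integrable_const _), integral_add (integrable_const _) hi,
          integral_div, integral_const_mul]
        simp
    _ ≤ m + C * (|y| + √(1 + s)) / (1 + s) + C / √(1 + s) := by
        gcongr
        refine (S.integral_abs_startedAt_le y u).trans ?_
        gcongr
    _ = _ := by
        have : C * √(1 + s) / (1 + s) = C / √(1 + s) := by
          rw [div_eq_div_iff (by positivity) hq.ne', mul_assoc,
            Real.mul_self_sqrt (by positivity)]
        rw [mul_add, add_div, this]
        ring

theorem tendsto_integral_value (S : BoundedSetting P B a₁ a₂ c₀ C M) {L : ℝ}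
    (hL : Tendsto (drift a₁ a₂ c₀) atTop (𝓝 L)) (s : ℝ≥0) (y : ℝ) :
    Tendsto (fun u : ℝ≥0 => ∫ ω, value P B S.meas a₁ a₂ c₀ (s + u) (startedAt B y u ω) ∂P)
      atTop (𝓝 L) := by
  have hT : Tendsto (fun u : ℝ≥0 => ((s + u : ℝ≥0) : ℝ)) atTop atTop :=
    NNReal.tendsto_coe_atTop.2 (tendsto_atTop_mono (fun _ => le_add_self) tendsto_id)
  have hT1 : Tendsto (fun u : ℝ≥0 => 1 + ((s + u : ℝ≥0) : ℝ)) atTop atTop :=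
    tendsto_atTop_add_const_left _ _ hT
  have hy : Tendsto (fun u : ℝ≥0 => C * |y| / (1 + ((s + u : ℝ≥0) : ℝ))) atTop (𝓝 0) :=
    hT1.const_div_atTop _
  have hq : Tendsto (fun u : ℝ≥0 => 2 * C / √(1 + ((s + u : ℝ≥0) : ℝ))) atTop (𝓝 0) :=
    (Real.tendsto_sqrt_atTop.comp hT1).const_div_atTop _
  refine tendsto_order.2 ⟨fun a ha => ?_, fun b hb => ?_⟩
  · have hlow := (hL.comp hT).sub hy
    rw [sub_zero] at hlow
    filter_upwards [hlow.eventually_const_lt ha] with u hu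
    exact hu.trans_le (S.le_integral_value _ y u)
  -- A level m strictly between L and b eventually dominates `drift`, leaving room b - m for the
  -- vanishing errors.
  · obtain ⟨m, hLm, hmb⟩ := exists_between hb
    have hup := ((tendsto_const_nhds (x := m)).add hy).add hq
    rw [add_zero, add_zero] at hup
    obtain ⟨T, hTm⟩ := eventually_atTop.1 (hL.eventually_lt_const hLm)
    filter_upwards [hup.eventually_lt_const hmb, hT.eventually_ge_atTop T] with u hu huT
    exact (S.integral_value_le (fun t ht => (hTm t (huT.trans ht)).le) y le_add_self).trans_lt hu

end BoundedSetting

theorem GainAssumptions.exists_boundedSetting {P : Measure Ω} {B : ℝ≥0 → Ω → ℝ}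
    (hBm : ∀ t, Measurable (B t)) (hB : IsBrownianReal B P) {a₁ a₂ : ℝ → ℝ} {c₁ c₂ : ℝ}
    (h : GainAssumptions a₁ a₂ c₁ c₂) (c₀ : ℝ) : ∃ C M, BoundedSetting P B a₁ a₂ c₀ C M := by
  obtain ⟨C, hC, hCt⟩ := h.exists_abs_mul_le
  obtain ⟨M, hM⟩ := h.exists_abs_drift_le c₀
  exact ⟨C, M, hBm, hB, h.regular₁, h.regular₂, hC, hCt, hM⟩

end Value

end GaussMarkovOSP

theorem mainTheorem11 {Ω : Type*} [MeasurableSpace Ω] (P : Measure Ω)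
    (B : ℝ≥0 → Ω → ℝ) (hBm : ∀ t, Measurable (B t)) (hB : IsBrownianReal B P)
    (a₁ a₂ : ℝ → ℝ) (c₀ c₁ c₂ : ℝ) (h : GaussMarkovOSP.GainAssumptions a₁ a₂ c₁ c₂) :
    -- the expectations and the supremum that define the value function are genuine
    (∀ (s : ℝ≥0) (y : ℝ),
      (∀ σ : Ω → WithTop ℝ≥0, GaussMarkovOSP.IsAdmissible P B hBm y σ →
        Integrable (GaussMarkovOSP.gainAt B a₁ a₂ c₀ s y σ) P) ∧
      BddAbove (GaussMarkovOSP.expectedGains P B hBm a₁ a₂ c₀ s y)) ∧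
    ∀ (s : ℝ≥0) (y : ℝ),
      (∀ u : ℝ≥0, Integrable (fun ω => GaussMarkovOSP.value P B hBm a₁ a₂ c₀ (s + u)
        (GaussMarkovOSP.startedAt B y u ω)) P) ∧
      Tendsto (fun u : ℝ≥0 => ∫ ω, GaussMarkovOSP.value P B hBm a₁ a₂ c₀ (s + u)
        (GaussMarkovOSP.startedAt B y u ω) ∂P) atTop (𝓝 (c₁ + c₀ * c₂)) := by
  obtain ⟨C, M, S⟩ := h.exists_boundedSetting hBm hB c₀
  exact ⟨fun s y => ⟨fun σ hσ => S.integrable_gainAt s hσ, S.bddAbove_expectedGains s y⟩,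
    fun s y => ⟨fun u => S.integrable_value (s + u) y u,
      S.tendsto_integral_value (h.tendsto_drift c₀) s y⟩⟩
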